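/- Let $X$ and $Y$ be Banach spaces over $\mathbb{K}\in\{\mathbb{R},\mathbb{C}\}$, with $X$ separable and reflexive. Let $\mathcal{L}$ be a family of bounded linear operators $L:X\to Y$ (indexed by, and carrying the topology of) a $\sigma$-compact locally compact Hausdorff space, such that for every $x\in X$ the map $L\mapsto Lx$ from $\mathcal{L}$ to $Y$ with its norm topology is continuous. Put $$M(X,\mathcal{L})=\Big\{x\in X:\ \|x\|_{M}:=\sup_{L\in\mathcal{L}}\|Lx\|_Y<\infty\Big\},\qquad M_0(X,\mathcal{L})=\Big\{x\in M(X,\mathcal{L}):\ \lim_{\mathcal{L}\ni L\to\infty}\|Lx\|_Y=0\Big\},$$ where $L\to\infty$ means that $L$ eventually leaves every compact subset of $\mathcal{L}$, and where both spaces carry $\|\cdot\|_M$. Assume that $M(X,\mathcal{L})$ is continuously contained in $X$, i.e. there is a constant $C$ with $\|x\|_X\le C\|x\|_{M}$ for all $x\in M(X,\mathcal{L})$ (then $\|\cdot\|_M$ is a complete norm on $M(X,\mathcal{L})$). Assume moreover that for every $x\in M(X,\mathcal{L})$ there is a sequence $(x_n)$ in $M_0(X,\mathcal{L})$ such that $x_n\to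 x$ in $X$ and $\sup_n\|x_n\|_{M}\le\|x\|_{M}$. Then $Z:=M_0(X,\mathcal{L})^*$ is the strongly unique isometric predual of $M(X,\mathcal{L})$. That is: 1. $Z^*=M_0(X,\mathcal{L})^{**}$ is isometrically isomorphic to $M(X,\mathcal{L})$, through a linear surjective isometry $I:M_0(X,\mathcal{L})^{**}\to M(X,\mathcal{L})$ with $x^*(Im)=m\big(x^*|_{M_0(X,\mathcal{L})}\big)$ for all $m\in M_0(X,\mathcal{L})^{**}$ and $x^*\in X^*$. 2. The canonical projection $\pi:Z^{***}\to Z^*$, $(\pi z^{***})(z)=z^{***}(z)$ for $z\in Z$, is the only bounded linear projection from $Z^{***}$ onto $Z^*$ of norm one whose kernel is weak-star closed in $Z^{***}=(Z^{**})^*$. (If $Z=0$, read "norm at most one".) 3. If $W$ is any Banach space over $\mathbb{K}$ whose dual $W^*$ is linearly isometric to $M(X,\mathcal{L})$, then $W$ is linearly isometric to $Z$. -/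

import Mathlib

open Filter Topology

set_option maxSynthPendingDepth 3

/-- The elements `x` of `X` with `sup_L ‖L x‖ < ∞`, as a linear subspace of `X`. -/
def bigSubmodule {𝕜 X Y ι : Type*} [RCLike 𝕜] [NormedAddCommGroup X] [NormedSpace 𝕜 X]
    [NormedAddCommGroup Y] [NormedSpace 𝕜 Y] (Λ : ι → X →L[𝕜] Y) : Submodule 𝕜 X where
  carrier := {x | BddAbove (Set.range fun i => ‖Λ i x‖)}
  zero_mem' := ⟨0, by rintro _ ⟨i, rfl⟩; simp⟩
  add_mem' := by
    rintro x y ⟨a, ha⟩ ⟨b, hb⟩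
    refine ⟨a + b, ?_⟩
    rintro _ ⟨i, rfl⟩
    simp only [map_add]
    exact (norm_add_le _ _).trans (add_le_add (ha ⟨i, rfl⟩) (hb ⟨i, rfl⟩))
  smul_mem' := by
    rintro c x ⟨a, ha⟩
    refine ⟨‖c‖ * a, ?_⟩
    rintro _ ⟨i, rfl⟩
    simp only [map_smul, norm_smul]
    exact mul_le_mul_of_nonneg_left (ha ⟨i, rfl⟩) (norm_nonneg c)

/-- The space `M(X, 𝓛)`, where `𝓛` is the family `Λ`. It is a type of its own, so that it carries
the norm `sup_L ‖L x‖` defined below and not the norm of `X`. -/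
def BigSpace {𝕜 X Y ι : Type*} [RCLike 𝕜] [NormedAddCommGroup X] [NormedSpace 𝕜 X]
    [NormedAddCommGroup Y] [NormedSpace 𝕜 Y] (Λ : ι → X →L[𝕜] Y) : Type _ :=
  bigSubmodule Λ

namespace BigSpace

instance instAddCommGroup {𝕜 X Y ι : Type*} [RCLike 𝕜] [NormedAddCommGroup X] [NormedSpace 𝕜 X]
    [NormedAddCommGroup Y] [NormedSpace 𝕜 Y] (Λ : ι → X →L[𝕜] Y) : AddCommGroup (BigSpace Λ) :=
  inferInstanceAs (AddCommGroup (bigSubmodule Λ))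

instance instModule {𝕜 X Y ι : Type*} [RCLike 𝕜] [NormedAddCommGroup X] [NormedSpace 𝕜 X]
    [NormedAddCommGroup Y] [NormedSpace 𝕜 Y] (Λ : ι → X →L[𝕜] Y) : Module 𝕜 (BigSpace Λ) :=
  inferInstanceAs (Module 𝕜 (bigSubmodule Λ))

/-- The inclusion of `M(X, 𝓛)` into `X`. -/
def toX {𝕜 X Y ι : Type*} [RCLike 𝕜] [NormedAddCommGroup X] [NormedSpace 𝕜 X]
    [NormedAddCommGroup Y] [NormedSpace 𝕜 Y] (Λ : ι → X →L[𝕜] Y) : BigSpace Λ →ₗ[𝕜] X :=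
  (bigSubmodule Λ).subtype

theorem bddAbove {𝕜 X Y ι : Type*} [RCLike 𝕜] [NormedAddCommGroup X] [NormedSpace 𝕜 X]
    [NormedAddCommGroup Y] [NormedSpace 𝕜 Y] (Λ : ι → X →L[𝕜] Y) (x : BigSpace Λ) :
    BddAbove (Set.range fun i => ‖Λ i (toX Λ x)‖) :=
  x.2

/-- `x ↦ sup_L ‖L x‖` as a seminorm on `M(X, 𝓛)`. -/
noncomputable def supSeminorm {𝕜 X Y ι : Type*} [RCLike 𝕜] [NormedAddCommGroup X]
    [NormedSpace 𝕜 X] [NormedAddCommGroup Y] [NormedSpace 𝕜 Y] (Λ : ι → X →L[𝕜] Y) :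
    Seminorm 𝕜 (BigSpace Λ) :=
  Seminorm.of (fun x => ⨆ i, ‖Λ i (toX Λ x)‖)
    (by
      intro x y
      refine Real.iSup_le (fun i => ?_)
        (add_nonneg (Real.iSup_nonneg fun i => norm_nonneg _)
          (Real.iSup_nonneg fun i => norm_nonneg _))
      rw [map_add, map_add]
      exact (norm_add_le _ _).trans
        (add_le_add (le_ciSup (bddAbove Λ x) i) (le_ciSup (bddAbove Λ y) i)))
    (by
      intro c x
      simp only [map_smul, norm_smul]
      exact (Real.mul_iSup_of_nonneg (norm_nonneg c) _).symm)

/-- The topology of `M(X, 𝓛)` is the one of `sup_L ‖L x‖`. As soon as `M(X, 𝓛)` is continuously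
contained in `X`, this seminorm is a complete norm. -/
noncomputable instance instSeminormedAddCommGroup {𝕜 X Y ι : Type*} [RCLike 𝕜]
    [NormedAddCommGroup X] [NormedSpace 𝕜 X] [NormedAddCommGroup Y] [NormedSpace 𝕜 Y]
    (Λ : ι → X →L[𝕜] Y) : SeminormedAddCommGroup (BigSpace Λ) :=
  (supSeminorm Λ).toAddGroupSeminorm.toSeminormedAddCommGroup

theorem norm_def {𝕜 X Y ι : Type*} [RCLike 𝕜] [NormedAddCommGroup X] [NormedSpace 𝕜 X]
    [NormedAddCommGroup Y] [NormedSpace 𝕜 Y] (Λ : ι → X →L[𝕜] Y) (x : BigSpace Λ) :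
    ‖x‖ = ⨆ i, ‖Λ i (toX Λ x)‖ :=
  rfl

noncomputable instance instNormedSpace {𝕜 X Y ι : Type*} [RCLike 𝕜] [NormedAddCommGroup X]
    [NormedSpace 𝕜 X] [NormedAddCommGroup Y] [NormedSpace 𝕜 Y] (Λ : ι → X →L[𝕜] Y) :
    NormedSpace 𝕜 (BigSpace Λ) where
  norm_smul_le c x := (map_smul_eq_mul (supSeminorm Λ) c x).le

end BigSpace

/-- The subspace `M₀(X, 𝓛)` of `M(X, 𝓛)`, with the norm of `M(X, 𝓛)`: the elements `x` for which
`‖L x‖ → 0` as `L → ∞`, that is, as `L` leaves the compact subsets of the index space. -/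
def littleSpace {𝕜 X Y ι : Type*} [RCLike 𝕜] [NormedAddCommGroup X] [NormedSpace 𝕜 X]
    [NormedAddCommGroup Y] [NormedSpace 𝕜 Y] [TopologicalSpace ι] (Λ : ι → X →L[𝕜] Y) :
    Submodule 𝕜 (BigSpace Λ) where
  carrier := {x | Tendsto (fun i => ‖Λ i (BigSpace.toX Λ x)‖) (cocompact ι) (𝓝 0)}
  zero_mem' := by
    rw [Set.mem_ofPred_eq]
    simpa using tendsto_const_nhds
  add_mem' := by
    intro x y hx hy
    rw [Set.mem_ofPred_eq] at hx hy ⊢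
    refine squeeze_zero (fun i => norm_nonneg _) (fun i => ?_) (by simpa using hx.add hy)
    rw [map_add, map_add]
    exact norm_add_le _ _
  smul_mem' := by
    intro c x hx
    rw [Set.mem_ofPred_eq] at hx ⊢
    simpa [norm_smul] using hx.const_mul ‖c‖

/-- The canonical projection `Z*** → Z*`, which restricts a functional on `Z**` to `Z`. -/
noncomputable def canonicalProj (𝕜 Z : Type*) [RCLike 𝕜] [SeminormedAddCommGroup Z]
    [NormedSpace 𝕜 Z] :
    StrongDual 𝕜 (StrongDual 𝕜 (StrongDual 𝕜 Z)) →L[𝕜] StrongDual 𝕜 Z :=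
  ContinuousLinearMap.precomp 𝕜 (NormedSpace.inclusionInDoubleDual 𝕜 Z)

/-- `Z` is a strongly unique predual (of `Z*`): the canonical projection is the only linear
projection of norm one from `Z***` to `Z*` with weak-star closed kernel. Norm one is written as
norm at most one, which is the same unless `Z = 0`, where all these maps are zero. -/
def IsStronglyUniquePredual (𝕜 Z : Type*) [RCLike 𝕜] [SeminormedAddCommGroup Z]
    [NormedSpace 𝕜 Z] : Prop :=
  ∀ π : StrongDual 𝕜 (StrongDual 𝕜 (StrongDual 𝕜 Z)) →L[𝕜] StrongDual 𝕜 Z,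
    ((∀ f : StrongDual 𝕜 Z, π (NormedSpace.inclusionInDoubleDual 𝕜 (StrongDual 𝕜 Z) f) = f) ∧
      ‖π‖ ≤ 1 ∧
      IsClosed {φ : WeakDual 𝕜 (StrongDual 𝕜 (StrongDual 𝕜 Z)) |
        π (WeakDual.toStrongDual φ) = 0}) ↔
    π = canonicalProj 𝕜 Z

/-! Write `E` for `M₀`. It embeds isometrically in `C₀(𝓛, Y)`, where every functional is
concentrated, up to `ε`, on a compact set (`exists_cutoff`); on compact sets the operators are
uniformly bounded on `X` by Banach–Steinhaus. Hence `X*` is dense in `E*`, and `E**` injects into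
`X** = X`. Its image is `M`: testing against `Y*` gives one norm inequality, and weak-star limits of
the approximating sequences give surjectivity and the other inequality.

Uniqueness holds because `v ∈ M₀` and the tail of `x - u n` almost live on disjoint parts of `𝓛`, so
that eventually `‖v + x - u n‖ ≤ max ‖v‖ (2‖x‖) + ε`. If `y` lies in every closed ball that
eventually contains `u n`, then `z = x - y` satisfies `‖v + z‖ ≤ max ‖v‖ (2‖x‖)` for all `v ∈ M`,
and `v = k z` with `k` large forces `z = 0`. A competing projection or predual supplies, by
weak-star compactness, such a `y` with `f (u n) → f y` for the relevant `f ∈ E***`; thus `f (u n) →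
f x`. The same sequence also tends to the value at `x` of `f|_E ∈ E*`, so `f` comes from `E*`, which
identifies the competitor with the canonical object. -/

/-! ### Weak-star limits and separation -/

/-- A bounded family in a dual space converges pointwise along every ultrafilter. -/
theorem StrongDual.exists_forall_tendsto_of_bounded {𝕜 F α : Type*} [RCLike 𝕜]
    [SeminormedAddCommGroup F] [NormedSpace 𝕜 F] (U : Ultrafilter α) (a : α → StrongDual 𝕜 F)
    {r : ℝ} (h : ∀ n, ‖a n‖ ≤ r) :
    ∃ φ : StrongDual 𝕜 F, ∀ f, Tendsto (fun n => a n f) U (𝓝 (φ f)) := by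
  have hK := WeakDual.isCompact_closedBall (𝕜 := 𝕜) (E := F) 0 r
  obtain ⟨φ, -, hφ⟩ := hK.ultrafilter_le_nhds (U.map fun n => StrongDual.toWeakDual (a n)) (by
    rw [le_principal_iff]
    refine Filter.mem_map.2 (Filter.univ_mem' fun n => ?_)
    simpa using h n)
  refine ⟨WeakDual.toStrongDual φ, fun f => ?_⟩
  exact ((WeakDual.eval_continuous f).tendsto φ).comp hφ

/-- The dual norm is lower semicontinuous for pointwise convergence. -/
theorem StrongDual.norm_le_of_tendsto {𝕜 F α : Type*} [RCLike 𝕜]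
    [SeminormedAddCommGroup F] [NormedSpace 𝕜 F] {l : Filter α} [l.NeBot]
    {a : α → StrongDual 𝕜 F} {φ : StrongDual 𝕜 F}
    (h : ∀ f, Tendsto (fun n => a n f) l (𝓝 (φ f))) {s : ℝ} (hs : ∀ᶠ n in l, ‖a n‖ ≤ s) :
    ‖φ‖ ≤ s := by
  obtain ⟨n, hn⟩ := hs.exists
  refine φ.opNorm_le_bound ((norm_nonneg _).trans hn) fun f => ?_
  refine le_of_tendsto (h f).norm (hs.mono fun n hn => ?_)
  exact ((a n).le_opNorm f).trans (mul_le_mul_of_nonneg_right hn (norm_nonneg f))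

/-- A closed subspace of a locally convex space is determined by the functionals it annihilates. -/
theorem Submodule.exists_strongDual_ne_zero_of_notMem {𝕜 V : Type*} [RCLike 𝕜] [AddCommGroup V]
    [TopologicalSpace V] [IsTopologicalAddGroup V] [Module 𝕜 V] [ContinuousSMul 𝕜 V] [Module ℝ V]
    [IsScalarTower ℝ 𝕜 V] [LocallyConvexSpace ℝ V] (S : Submodule 𝕜 V)
    (hS : IsClosed (S : Set V)) {x : V} (hx : x ∉ S) :
    ∃ g : StrongDual 𝕜 V, (∀ y ∈ S, g y = 0) ∧ g x ≠ 0 := by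
  obtain ⟨g, u, hgu, hu⟩ := RCLike.geometric_hahn_banach_point_closed (𝕜 := 𝕜)
    (S.restrictScalars ℝ).convex hS hx
  have hu0 : u < 0 := by simpa using hu 0 S.zero_mem
  refine ⟨g, fun y hy => ?_, fun h0 => ?_⟩
  · by_contra hne
    -- The multiple of `y` is scaled so that `g` takes exactly the value `u`, which the strict
    -- separation forbids on `S`.
    have := hu (((u : 𝕜) * (g y)⁻¹) • y) (S.smul_mem _ hy)
    rw [map_smul, smul_eq_mul, inv_mul_cancel_right₀ hne, RCLike.ofReal_re] at this
    exact lt_irrefl _ this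
  · rw [h0, map_zero] at hgu
    exact lt_asymm hgu hu0

/-- A weak-star closed subspace of a dual space is determined by the vectors it annihilates. -/
theorem WeakDual.exists_apply_ne_zero_of_notMem {𝕜 F : Type*} [RCLike 𝕜]
    [SeminormedAddCommGroup F] [NormedSpace 𝕜 F] (S : Submodule 𝕜 (WeakDual 𝕜 F))
    (hS : IsClosed (S : Set (WeakDual 𝕜 F))) {ψ : WeakDual 𝕜 F} (hψ : ψ ∉ S) :
    ∃ f : F, (∀ χ ∈ S, χ f = 0) ∧ ψ f ≠ 0 := by
  have : LocallyConvexSpace ℝ (WeakDual 𝕜 F) :=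
    (WeakDual.withSeminorms 𝕜 F).toLocallyConvexSpace
  obtain ⟨g, hg⟩ := S.exists_strongDual_ne_zero_of_notMem hS hψ
  obtain ⟨f, rfl⟩ := LinearMap.dualEmbedding_surjective (topDualPairing 𝕜 F) g
  exact ⟨f, hg⟩

theorem norm_add_norm_le_of_forall_unit {𝕜 : Type*} [RCLike 𝕜] {a b : 𝕜} {s : ℝ}
    (h : ∀ t : 𝕜, ‖t‖ = 1 → ‖a + t * b‖ ≤ s) : ‖a‖ + ‖b‖ ≤ s := by
  obtain ⟨c, hc, hca⟩ := RCLike.exists_norm_eq_mul_self a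
  obtain ⟨d, hd, hdb⟩ := RCLike.exists_norm_eq_mul_self b
  have hc0 : c ≠ 0 := by
    rintro rfl
    simp at hc
  have e : c * (a + c⁻¹ * d * b) = ((‖a‖ + ‖b‖ : ℝ) : 𝕜) := by
    rw [RCLike.ofReal_add]
    refine Eq.trans ?_ (congrArg₂ (· + ·) hca hdb).symm
    field_simp
  have := h (c⁻¹ * d) (by simp [hc, hd])
  rw [← one_mul ‖a + _‖, ← hc, ← norm_mul, e, RCLike.norm_ofReal,
    abs_of_nonneg (by positivity)] at this
  exact this

/-! ### Functionals on `C₀(ι, Y)` -/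

open scoped ZeroAtInfty

theorem ZeroAtInftyContinuousMap.norm_apply_le {ι Y : Type*} [TopologicalSpace ι]
    [NormedAddCommGroup Y] (f : C₀(ι, Y)) (i : ι) : ‖f i‖ ≤ ‖f‖ :=
  f.toBCF.norm_coe_le_norm i

theorem ZeroAtInftyContinuousMap.norm_le_of_forall {ι Y : Type*} [TopologicalSpace ι]
    [NormedAddCommGroup Y] {f : C₀(ι, Y)} {r : ℝ} (hr : 0 ≤ r) (h : ∀ i, ‖f i‖ ≤ r) : ‖f‖ ≤ r :=
  (BoundedContinuousFunction.norm_le (f := f.toBCF) hr).2 h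

/-- A functional on `C₀(ι, Y)` is approximated in norm by its restrictions to compact sets. -/
theorem ZeroAtInftyContinuousMap.exists_cutoff {𝕜 ι Y : Type*} [RCLike 𝕜] [TopologicalSpace ι]
    [T2Space ι] [LocallyCompactSpace ι] [NormedAddCommGroup Y] [NormedSpace 𝕜 Y]
    (ℓ : StrongDual 𝕜 C₀(ι, Y)) {ε : ℝ} (hε : 0 < ε) :
    ∃ φ : C(ι, ℝ), HasCompactSupport φ ∧ (∀ i, φ i ∈ Set.Icc (0 : ℝ) 1) ∧
      ∀ h k : C₀(ι, Y), (∀ i, k i = (φ i : 𝕜) • h i) → ‖ℓ (h - k)‖ ≤ ε * ‖h‖ := by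
  obtain ⟨δ, hδ, hδε⟩ : ∃ δ : ℝ, 0 < δ ∧ δ * ‖ℓ‖ + δ ≤ ε :=
    ⟨ε / (‖ℓ‖ + 1), by positivity, by field_simp; exact le_rfl⟩
  obtain ⟨f, hf, hℓf⟩ : ∃ f : C₀(ι, Y), ‖f‖ ≤ 1 ∧ ‖ℓ‖ - δ < ‖ℓ f‖ := by
    obtain ⟨f, hf, h⟩ := ℓ.exists_lt_apply_of_lt_opNorm (sub_lt_self ‖ℓ‖ hδ)
    exact ⟨f, hf.le, h⟩
  obtain ⟨K, hK, hKf⟩ : ∃ K : Set ι, IsCompact K ∧ ∀ i ∉ K, ‖f i‖ < δ := by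
    have := (tendsto_zero_iff_norm_tendsto_zero.1 f.zero_at_infty').eventually_lt_const hδ
    obtain ⟨K, hK, h⟩ := mem_cocompact.1 this
    exact ⟨K, hK, fun i hi => h hi⟩
  obtain ⟨φ, hφ1, -, hφc, hφ⟩ := exists_continuous_one_zero_of_isCompact hK isClosed_empty
    (Set.disjoint_empty K)
  refine ⟨φ, hφc, hφ, ?_⟩
  have key : ∀ h k : C₀(ι, Y), (∀ i, k i = (φ i : 𝕜) • h i) → ‖h‖ ≤ 1 → ‖ℓ (h - k)‖ ≤ ε := by
    intro h k hk hh
    -- `h - k` vanishes on `K`, and `f` is smaller than `δ` off `K`, so adding any unimodular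
    -- multiple of `h - k` to `f` keeps the norm below `1 + δ`. As `f` almost attains `‖ℓ‖`, at most
    -- `δ * ‖ℓ‖ + δ` is left for `h - k`.
    have hsum : ‖ℓ f‖ + ‖ℓ (h - k)‖ ≤ ‖ℓ‖ * (1 + δ) := by
      refine norm_add_norm_le_of_forall_unit fun t ht => ?_
      rw [← smul_eq_mul, ← map_smul, ← map_add]
      refine (ℓ.le_opNorm _).trans (mul_le_mul_of_nonneg_left ?_ (norm_nonneg _))
      refine ZeroAtInftyContinuousMap.norm_le_of_forall (by positivity) fun i => ?_
      have e : (f + t • (h - k)) i = f i + (t * ((1 - φ i : ℝ) : 𝕜)) • h i := by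
        change f i + t • (h i - k i) = _
        rw [hk i, mul_smul]
        push_cast
        rw [sub_smul, one_smul]
      rw [e]
      refine (norm_add_le _ _).trans ?_
      rw [norm_smul, norm_mul, ht, one_mul, RCLike.norm_ofReal,
        abs_of_nonneg (sub_nonneg.2 (hφ i).2)]
      by_cases hi : i ∈ K
      · rw [hφ1 hi]
        simp only [Pi.one_apply, sub_self, zero_mul, add_zero]
        exact (f.norm_apply_le i).trans (hf.trans (by linarith))
      · have h1 := hKf i hi
        have h2 := (h.norm_apply_le i).trans hh
        have h3 := mul_le_one₀ (sub_le_self 1 (hφ i).1) (norm_nonneg (h i)) h2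
        linarith
    nlinarith
  intro h k hk
  rcases eq_or_ne ‖h‖ 0 with h0 | h0
  · have hz : h = 0 := norm_eq_zero.1 h0
    have kz : k = 0 := by
      ext i
      rw [hk i, hz]
      simp
    simp [hz, kz]
  · have := key (((‖h‖⁻¹ : ℝ) : 𝕜) • h) (((‖h‖⁻¹ : ℝ) : 𝕜) • k)
      (fun i => by
        change ((‖h‖⁻¹ : ℝ) : 𝕜) • k i = (φ i : 𝕜) • ((‖h‖⁻¹ : ℝ) : 𝕜) • h i
        rw [hk i, smul_comm])
      (by rw [norm_smul, RCLike.norm_ofReal, abs_of_nonneg (by positivity), inv_mul_cancel₀ h0])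
    rw [← smul_sub, map_smul, norm_smul, RCLike.norm_ofReal, abs_of_nonneg (by positivity),
      inv_mul_le_iff₀ (by positivity)] at this
    linarith

theorem exists_bound_on_isCompact {𝕜 X Y ι : Type*} [RCLike 𝕜]
    [NormedAddCommGroup X] [NormedSpace 𝕜 X] [CompleteSpace X]
    [NormedAddCommGroup Y] [NormedSpace 𝕜 Y] [TopologicalSpace ι] {Λ : ι → X →L[𝕜] Y}
    (hcont : ∀ x : X, Continuous fun i => Λ i x) {K : Set ι} (hK : IsCompact K) :
    ∃ C : ℝ, 0 ≤ C ∧ ∀ i ∈ K, ∀ x, ‖Λ i x‖ ≤ C * ‖x‖ := by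
  obtain ⟨C, hC⟩ := banach_steinhaus (g := fun i : K => Λ i) fun x => by
    obtain ⟨C, hC⟩ := hK.exists_bound_of_continuousOn (hcont x).continuousOn
    exact ⟨C, fun i => hC i i.2⟩
  refine ⟨max C 0, le_max_right _ _, fun i hi x => ?_⟩
  exact (Λ i).le_of_opNorm_le ((hC ⟨i, hi⟩).trans (le_max_left _ _)) x

namespace BigSpace

section

variable {𝕜 X Y ι : Type*} [RCLike 𝕜] [NormedAddCommGroup X] [NormedSpace 𝕜 X]
  [NormedAddCommGroup Y] [NormedSpace 𝕜 Y] {Λ : ι → X →L[𝕜] Y}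

theorem norm_apply_le (x : BigSpace Λ) (i : ι) : ‖Λ i (toX Λ x)‖ ≤ ‖x‖ :=
  le_ciSup (bddAbove Λ x) i

theorem norm_le_of_forall {x : BigSpace Λ} {r : ℝ} (hr : 0 ≤ r)
    (h : ∀ i, ‖Λ i (toX Λ x)‖ ≤ r) : ‖x‖ ≤ r :=
  Real.iSup_le h hr

theorem toX_injective : Function.Injective (toX Λ) :=
  (bigSubmodule Λ).injective_subtype

theorem eq_zero_of_norm_eq_zero (hM : ∃ C : ℝ, ∀ x : BigSpace Λ, ‖toX Λ x‖ ≤ C * ‖x‖)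
    {x : BigSpace Λ} (hx : ‖x‖ = 0) : x = 0 := by
  obtain ⟨C, hC⟩ := hM
  refine toX_injective ?_
  have := hC x
  rw [hx, mul_zero] at this
  rw [map_zero, norm_le_zero_iff.1 this]

end

end BigSpace

/-! ### Density of `X*` in the dual of `M₀`, and the bidual -/

section

variable {𝕜 X Y ι : Type*} [RCLike 𝕜] [NormedAddCommGroup X] [NormedSpace 𝕜 X]
  [NormedAddCommGroup Y] [NormedSpace 𝕜 Y] [TopologicalSpace ι] {Λ : ι → X →L[𝕜] Y}

/-- The continuous inclusion of `M₀(X, 𝓛)` into `X`. -/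
noncomputable def littleSpaceInclusion
    (hM : ∃ C : ℝ, ∀ x : BigSpace Λ, ‖BigSpace.toX Λ x‖ ≤ C * ‖x‖) : littleSpace Λ →L[𝕜] X :=
  (BigSpace.toX Λ ∘ₗ (littleSpace Λ).subtype).mkContinuousOfExistsBound
    (hM.imp fun _ hC y => hC y)

theorem littleSpaceInclusion_apply
    (hM : ∃ C : ℝ, ∀ x : BigSpace Λ, ‖BigSpace.toX Λ x‖ ≤ C * ‖x‖) (y : littleSpace Λ) :
    littleSpaceInclusion hM y = BigSpace.toX Λ y :=
  rfl

/-- The isometric embedding `x ↦ (L ↦ L x)` of `M₀(X, 𝓛)` into `C₀(𝓛, Y)`. -/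
noncomputable def littleSpaceToZeroAtInfty (hcont : ∀ x : X, Continuous fun i => Λ i x) :
    littleSpace Λ →ₗ[𝕜] C₀(ι, Y) where
  toFun y := ⟨⟨fun i => Λ i (BigSpace.toX Λ y), hcont _⟩, tendsto_zero_iff_norm_tendsto_zero.2 y.2⟩
  map_add' x y := by
    ext i
    exact map_add (Λ i) _ _
  map_smul' c x := by
    ext i
    exact map_smul (Λ i) c _

theorem norm_littleSpaceToZeroAtInfty (hcont : ∀ x : X, Continuous fun i => Λ i x)
    (y : littleSpace Λ) : ‖littleSpaceToZeroAtInfty hcont y‖ = ‖y‖ := by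
  refine le_antisymm ?_ ?_
  · exact ZeroAtInftyContinuousMap.norm_le_of_forall (norm_nonneg y)
      fun i => BigSpace.norm_apply_le (y : BigSpace Λ) i
  · exact BigSpace.norm_le_of_forall (norm_nonneg _)
      fun i => (littleSpaceToZeroAtInfty hcont y).norm_apply_le i

/-- Hahn–Banach on the range of the isometric embedding; `hM` makes the seminorm definite, hence the
embedding injective. -/
theorem exists_extension_to_zeroAtInfty (hcont : ∀ x : X, Continuous fun i => Λ i x)
    (hM : ∃ C : ℝ, ∀ x : BigSpace Λ, ‖BigSpace.toX Λ x‖ ≤ C * ‖x‖)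
    (ℓ : StrongDual 𝕜 (littleSpace Λ)) :
    ∃ ℓ' : StrongDual 𝕜 C₀(ι, Y), ∀ y, ℓ' (littleSpaceToZeroAtInfty hcont y) = ℓ y := by
  have hinj : Function.Injective (littleSpaceToZeroAtInfty hcont) := by
    refine (injective_iff_map_eq_zero _).2 fun y hy => Subtype.ext ?_
    refine BigSpace.eq_zero_of_norm_eq_zero hM ?_
    change ‖y‖ = 0
    rw [← norm_littleSpaceToZeroAtInfty hcont, hy, norm_zero]
  let e := LinearEquiv.ofInjective _ hinj
  have he : ∀ v, ‖e.symm v‖ = ‖v‖ := fun v => by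
    rw [← norm_littleSpaceToZeroAtInfty hcont]
    exact congrArg norm
      (LinearEquiv.ofInjective_symm_apply (f := littleSpaceToZeroAtInfty hcont) (h := hinj) v)
  obtain ⟨ℓ', hℓ', -⟩ := exists_extension_norm_eq _
    ((ℓ.toLinearMap ∘ₗ e.symm.toLinearMap).mkContinuous ‖ℓ‖ fun v => by
      rw [← he v]
      exact ℓ.le_opNorm _)
  refine ⟨ℓ', fun y => ?_⟩
  refine (hℓ' (e y)).trans ?_
  exact congrArg ℓ (e.symm_apply_apply y)

/-- The functionals on `X` are norm dense in the dual of `M₀(X, 𝓛)`. -/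
theorem exists_dual_norm_sub_comp_le [CompleteSpace X] [T2Space ι] [LocallyCompactSpace ι]
    (hcont : ∀ x : X, Continuous fun i => Λ i x)
    (hM : ∃ C : ℝ, ∀ x : BigSpace Λ, ‖BigSpace.toX Λ x‖ ≤ C * ‖x‖)
    (ℓ : StrongDual 𝕜 (littleSpace Λ)) {ε : ℝ} (hε : 0 < ε) :
    ∃ g : StrongDual 𝕜 X, ‖ℓ - g.comp (littleSpaceInclusion hM)‖ ≤ ε := by
  obtain ⟨ℓ', hℓ'⟩ := exists_extension_to_zeroAtInfty hcont hM ℓ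
  obtain ⟨φ, hφc, hφ, hcut⟩ := ZeroAtInftyContinuousMap.exists_cutoff ℓ' hε
  obtain ⟨C, hC0, hC⟩ := exists_bound_on_isCompact hcont hφc
  have hsupp : ∀ x : X, HasCompactSupport fun i => (φ i : 𝕜) • Λ i x := fun x => by
    refine hφc.mono fun i hi h0 => hi ?_
    change φ i = 0 at h0
    simp [h0]
  -- Cutting off by `φ` makes `L ↦ L x` vanish at infinity for every `x ∈ X`, not only for `x ∈ M₀`;
  -- so `ℓ'` composed with the cutoff is a functional on all of `X`.
  let V : X →ₗ[𝕜] C₀(ι, Y) :=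
    { toFun x := ⟨⟨fun i => (φ i : 𝕜) • Λ i x,
        (RCLike.continuous_ofReal.comp φ.continuous).smul (hcont x)⟩,
          (hsupp x).is_zero_at_infty⟩
      map_add' x y := by
        ext i
        change (φ i : 𝕜) • Λ i (x + y) = (φ i : 𝕜) • Λ i x + (φ i : 𝕜) • Λ i y
        rw [map_add, smul_add]
      map_smul' c x := by
        ext i
        change (φ i : 𝕜) • Λ i (c • x) = c • (φ i : 𝕜) • Λ i x
        rw [map_smul, smul_comm] }
  have hV : ∀ x, ‖V x‖ ≤ C * ‖x‖ := fun x => by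
    refine ZeroAtInftyContinuousMap.norm_le_of_forall (by positivity) fun i => ?_
    change ‖(φ i : 𝕜) • Λ i x‖ ≤ _
    by_cases hi : i ∈ tsupport φ
    · rw [norm_smul, RCLike.norm_ofReal, abs_of_nonneg (hφ i).1]
      exact (mul_le_of_le_one_left (norm_nonneg _) (hφ i).2).trans (hC i hi x)
    · rw [image_eq_zero_of_notMem_tsupport hi]
      simp only [map_zero, zero_smul, norm_zero]
      positivity
  refine ⟨ℓ'.comp (V.mkContinuous C hV), ContinuousLinearMap.opNorm_le_bound _ hε.le fun y => ?_⟩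
  have := hcut (littleSpaceToZeroAtInfty hcont y) (V (BigSpace.toX Λ y)) fun i => rfl
  rw [map_sub, hℓ', norm_littleSpaceToZeroAtInfty] at this
  exact this

/-- Functionals on the dual of `M₀(X, 𝓛)` are determined by their values on `X*`. -/
theorem bidual_littleSpace_ext [CompleteSpace X] [T2Space ι] [LocallyCompactSpace ι]
    (hcont : ∀ x : X, Continuous fun i => Λ i x)
    (hM : ∃ C : ℝ, ∀ x : BigSpace Λ, ‖BigSpace.toX Λ x‖ ≤ C * ‖x‖)
    {m m' : StrongDual 𝕜 (StrongDual 𝕜 (littleSpace Λ))}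
    (h : ∀ g : StrongDual 𝕜 X,
      m (g.comp (littleSpaceInclusion hM)) = m' (g.comp (littleSpaceInclusion hM))) :
    m = m' := by
  ext ℓ
  rw [← sub_eq_zero, ← norm_le_zero_iff]
  refine le_of_forall_pos_le_add fun δ hδ => ?_
  obtain ⟨g, hg⟩ := exists_dual_norm_sub_comp_le hcont hM ℓ
    (ε := δ / (‖m - m'‖ + 1)) (by positivity)
  have e : m ℓ - m' ℓ = (m - m') (ℓ - g.comp (littleSpaceInclusion hM)) := by
    change _ = m _ - m' _
    rw [map_sub, map_sub, h g]
    ring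
  rw [e, zero_add]
  refine ((m - m').le_of_opNorm_le_of_le le_rfl hg).trans ?_
  rw [mul_div_assoc', div_le_iff₀ (by positivity)]
  nlinarith [norm_nonneg (m - m')]

/-- For reflexive `X`, the bidual of `M₀(X, 𝓛)` is `M(X, 𝓛)`. -/
theorem exists_bidual_littleSpace_isometry [CompleteSpace X]
    [T2Space ι] [LocallyCompactSpace ι]
    (hrefl : Function.Surjective (NormedSpace.inclusionInDoubleDual 𝕜 X))
    (hcont : ∀ x : X, Continuous fun i => Λ i x)
    (hM : ∃ C : ℝ, ∀ x : BigSpace Λ, ‖BigSpace.toX Λ x‖ ≤ C * ‖x‖)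
    (happrox : ∀ x : BigSpace Λ, ∃ u : ℕ → littleSpace Λ,
      Tendsto (fun n => BigSpace.toX Λ (u n)) atTop (𝓝 (BigSpace.toX Λ x)) ∧
      ∀ n, ‖u n‖ ≤ ‖x‖) :
    ∃ I : StrongDual 𝕜 (StrongDual 𝕜 (littleSpace Λ)) ≃ₗᵢ[𝕜] BigSpace Λ,
      ∀ (m : StrongDual 𝕜 (StrongDual 𝕜 (littleSpace Λ))) (g : StrongDual 𝕜 X),
        g (BigSpace.toX Λ (I m)) = m (g.comp (littleSpaceInclusion hM)) := by
  let j := littleSpaceInclusion hM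
  let e := LinearIsometryEquiv.ofSurjective (NormedSpace.inclusionInDoubleDualLi 𝕜 (E := X)) hrefl
  -- The second adjoint of the inclusion `j`, with `X**` identified with `X` by reflexivity.
  let T : StrongDual 𝕜 (StrongDual 𝕜 (littleSpace Λ)) →ₗ[𝕜] X :=
    e.symm.toLinearEquiv.toLinearMap ∘ₗ
      (ContinuousLinearMap.precomp 𝕜 (ContinuousLinearMap.precomp 𝕜 j)).toLinearMap
  have hT : ∀ m (g : StrongDual 𝕜 X), g (T m) = m (g.comp j) := fun m g => by
    change e (e.symm _) g = _
    rw [e.apply_symm_apply]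
    rfl
  have hbound : ∀ m i, ‖Λ i (T m)‖ ≤ ‖m‖ := fun m i => by
    refine NormedSpace.norm_le_dual_bound 𝕜 _ (norm_nonneg m) fun f => ?_
    change ‖(f.comp (Λ i)) (T m)‖ ≤ _
    rw [hT]
    refine m.le_of_opNorm_le_of_le le_rfl ?_
    refine ContinuousLinearMap.opNorm_le_bound _ (norm_nonneg f) fun y => ?_
    exact f.le_of_opNorm_le_of_le le_rfl (BigSpace.norm_apply_le (y : BigSpace Λ) i)
  let S : StrongDual 𝕜 (StrongDual 𝕜 (littleSpace Λ)) →ₗ[𝕜] BigSpace Λ :=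
    T.codRestrict (bigSubmodule Λ) fun m => ⟨‖m‖, by
      rintro _ ⟨i, rfl⟩
      exact hbound m i⟩
  have hSX : ∀ m, BigSpace.toX Λ (S m) = T m := fun m => rfl
  have hS_le : ∀ m, ‖S m‖ ≤ ‖m‖ := fun m =>
    BigSpace.norm_le_of_forall (norm_nonneg m) (hbound m)
  have hS_inj : ∀ m m', S m = S m' → m = m' := fun m m' h =>
    bidual_littleSpace_ext hcont hM fun g => by
      rw [← hT, ← hT, ← hSX, ← hSX, h]
  have hS_surj : ∀ x, ∃ m, S m = x ∧ ‖m‖ ≤ ‖x‖ := fun x => by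
    obtain ⟨u, hu, hux⟩ := happrox x
    have hb : ∀ n, ‖NormedSpace.inclusionInDoubleDual 𝕜 (littleSpace Λ) (u n)‖ ≤ ‖x‖ :=
      fun n => (NormedSpace.double_dual_bound 𝕜 _ _).trans (hux n)
    obtain ⟨m, hm⟩ := StrongDual.exists_forall_tendsto_of_bounded (hyperfilter ℕ) _ hb
    -- The weak-star limit `m` of the `u n` is sent to `x`, since on functionals from `X*` both are
    -- limits of `g (u n)`.
    refine ⟨m, BigSpace.toX_injective ?_, StrongDual.norm_le_of_tendsto hm (.of_forall hb)⟩
    refine (NormedSpace.inclusionInDoubleDualLi 𝕜 (E := X)).injective ?_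
    ext g
    change g (T m) = g (BigSpace.toX Λ x)
    rw [hT]
    refine tendsto_nhds_unique (hm (g.comp j)) ?_
    exact ((g.continuous.tendsto _).comp hu).mono_left Nat.hyperfilter_le_atTop
  have hS : ∀ m, ‖S m‖ = ‖m‖ := fun m => by
    obtain ⟨m', hm', hn⟩ := hS_surj (S m)
    rw [hS_inj _ _ hm'] at hn
    exact le_antisymm (hS_le m) hn
  exact ⟨⟨LinearEquiv.ofBijective S ⟨hS_inj, fun x => (hS_surj x).imp fun _ h => h.1⟩, hS⟩, hT⟩

end

/-! ### Uniqueness of the predual from limits along an ultrafilter -/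

section

variable {𝕜 E : Type*} [RCLike 𝕜] [SeminormedAddCommGroup E] [NormedSpace 𝕜 E]

/-- A functional `f` on `E**` comes from `E*` as soon as every bounded sequence `a` in `E**` admits
a point `y` with `f (a n) → f y` along a fixed ultrafilter and such that closed balls which
contain `a n` along the ultrafilter contain `y`. -/
def LimitFunctionalsComeFromDual (𝕜 E : Type*) [RCLike 𝕜] [SeminormedAddCommGroup E]
    [NormedSpace 𝕜 E] : Prop :=
  ∀ f : StrongDual 𝕜 (StrongDual 𝕜 (StrongDual 𝕜 E)),
    (∀ (a : ℕ → StrongDual 𝕜 (StrongDual 𝕜 E)) (r : ℝ), (∀ n, ‖a n‖ ≤ r) →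
      ∃ y, Tendsto (fun n => f (a n)) (hyperfilter ℕ) (𝓝 (f y)) ∧
        ∀ b s, (∀ᶠ n in (hyperfilter ℕ : Filter ℕ), ‖b - a n‖ ≤ s) → ‖b - y‖ ≤ s) →
    f = NormedSpace.inclusionInDoubleDual 𝕜 (StrongDual 𝕜 E)
      (f.comp (NormedSpace.inclusionInDoubleDual 𝕜 E))

theorem canonicalProj_inclusion (𝕜 : Type*) {Z : Type*} [RCLike 𝕜] [SeminormedAddCommGroup Z]
    [NormedSpace 𝕜 Z] (f : StrongDual 𝕜 Z) :
    canonicalProj 𝕜 Z (NormedSpace.inclusionInDoubleDual 𝕜 (StrongDual 𝕜 Z) f) = f :=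
  rfl

theorem norm_canonicalProj_le (𝕜 Z : Type*) [RCLike 𝕜] [SeminormedAddCommGroup Z]
    [NormedSpace 𝕜 Z] : ‖canonicalProj 𝕜 Z‖ ≤ 1 := by
  refine ContinuousLinearMap.opNorm_le_bound _ zero_le_one fun φ => ?_
  refine ContinuousLinearMap.opNorm_le_bound _ (by positivity) fun z => ?_
  rw [one_mul]
  exact φ.le_of_opNorm_le_of_le le_rfl (NormedSpace.double_dual_bound 𝕜 Z z)

theorem isClosed_ker_canonicalProj (𝕜 Z : Type*) [RCLike 𝕜] [SeminormedAddCommGroup Z]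
    [NormedSpace 𝕜 Z] :
    IsClosed {φ : WeakDual 𝕜 (StrongDual 𝕜 (StrongDual 𝕜 Z)) |
      canonicalProj 𝕜 Z (WeakDual.toStrongDual φ) = 0} := by
  have : {φ : WeakDual 𝕜 (StrongDual 𝕜 (StrongDual 𝕜 Z)) |
      canonicalProj 𝕜 Z (WeakDual.toStrongDual φ) = 0} =
      ⋂ z : Z, {φ | φ (NormedSpace.inclusionInDoubleDual 𝕜 Z z) = 0} := by
    ext φ
    simp only [Set.mem_iInter, Set.mem_ofPred_eq]
    exact ⟨fun h z => DFunLike.congr_fun h z, fun h => ContinuousLinearMap.ext h⟩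
  rw [this]
  exact isClosed_iInter fun z => isClosed_eq (WeakDual.eval_continuous _) continuous_const

/-- Both maps are projections, so it suffices that the canonical kernel lies in `ker π`. As `ker π`
is weak-star closed, it is cut out by the `f ∈ E***` that annihilate it. Each such `f` comes from
`E*`, where the canonical kernel vanishes. -/
theorem LimitFunctionalsComeFromDual.isStronglyUniquePredual
    (hE : LimitFunctionalsComeFromDual 𝕜 E) :
    IsStronglyUniquePredual 𝕜 (StrongDual 𝕜 E) := by
  intro π
  refine ⟨fun ⟨hproj, hnorm, hclosed⟩ => ?_, ?_⟩
  swap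
  · rintro rfl
    exact ⟨canonicalProj_inclusion 𝕜, norm_canonicalProj_le 𝕜 _, isClosed_ker_canonicalProj 𝕜 _⟩
  let ι₂ := NormedSpace.inclusionInDoubleDual 𝕜 (StrongDual 𝕜 (StrongDual 𝕜 E))
  let S : Submodule 𝕜 (WeakDual 𝕜 (StrongDual 𝕜 (StrongDual 𝕜 (StrongDual 𝕜 E)))) :=
    LinearMap.ker (π.toLinearMap ∘ₗ WeakDual.toStrongDual.toLinearMap)
  have hker : ∀ ψ, canonicalProj 𝕜 (StrongDual 𝕜 E) ψ = 0 → π ψ = 0 := by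
    intro ψ hψ
    by_contra hne
    obtain ⟨f, hf, hψf⟩ := WeakDual.exists_apply_ne_zero_of_notMem S hclosed
      (ψ := StrongDual.toWeakDual ψ) hne
    have hf' : ∀ χ, π χ = 0 → χ f = 0 := fun χ hχ => hf (StrongDual.toWeakDual χ) hχ
    refine hψf ?_
    have hfE := hE f fun a r ha => by
      obtain ⟨φ, hφ⟩ := StrongDual.exists_forall_tendsto_of_bounded (hyperfilter ℕ)
        (fun n => ι₂ (a n)) fun n => (NormedSpace.double_dual_bound 𝕜 _ _).trans (ha n)
      -- `f` kills `φ - π φ ∈ ker π`, so `f (π φ)` is the limit `φ f`; the ball condition passes to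
      -- `φ` by lower semicontinuity and to `π φ` because `π` is a contraction fixing `b`.
      refine ⟨π φ, ?_, fun b s hs => ?_⟩
      · have h0 := hf' (φ - ι₂ (π φ)) (by rw [map_sub, hproj, sub_self])
        have h1 : φ f = f (π φ) := sub_eq_zero.1 h0
        rw [← h1]
        exact hφ f
      · have hlim : ∀ g, Tendsto (fun n => ι₂ (b - a n) g) (hyperfilter ℕ)
            (𝓝 ((ι₂ b - φ) g)) := fun g => by
          have := (hφ g).const_sub (ι₂ b g)
          refine this.congr fun n => ?_
          rw [map_sub]
          rfl
        have h1 := StrongDual.norm_le_of_tendsto hlim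
          (hs.mono fun n hn => (NormedSpace.double_dual_bound 𝕜 _ _).trans hn)
        rw [← hproj b, ← map_sub]
        refine (π.le_of_opNorm_le hnorm _).trans ?_
        rwa [one_mul]
    change ψ f = 0
    rw [hfE]
    exact DFunLike.congr_fun hψ _
  ext1 φ
  have := hker (φ - ι₂ (canonicalProj 𝕜 _ φ)) (by rw [map_sub, canonicalProj_inclusion, sub_self])
  rwa [map_sub, hproj, sub_eq_zero] at this

/-- Each `w ∈ W` acts on `E**` through `T`. Weak-star limits in `W*`, transported by `T`, satisfy
the limit condition for this functional, so it comes from `E*`; this places `W` inside `E*`. -/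
theorem LimitFunctionalsComeFromDual.nonempty_isometry
    (hE : LimitFunctionalsComeFromDual 𝕜 E) {W : Type*} [NormedAddCommGroup W] [NormedSpace 𝕜 W]
    [CompleteSpace W] (T : StrongDual 𝕜 W ≃ₗᵢ[𝕜] StrongDual 𝕜 (StrongDual 𝕜 E)) :
    Nonempty (W ≃ₗᵢ[𝕜] StrongDual 𝕜 E) := by
  let Tc : StrongDual 𝕜 (StrongDual 𝕜 E) →L[𝕜] StrongDual 𝕜 W :=
    T.symm.toContinuousLinearEquiv.toContinuousLinearMap
  let j : W →ₗ[𝕜] StrongDual 𝕜 (StrongDual 𝕜 (StrongDual 𝕜 E)) :=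
    (ContinuousLinearMap.precomp 𝕜 Tc).toLinearMap ∘ₗ
      (NormedSpace.inclusionInDoubleDual 𝕜 W).toLinearMap
  have hj : ∀ w a, j w a = T.symm a w := fun _ _ => rfl
  let R : W →ₗ[𝕜] StrongDual 𝕜 E :=
    (ContinuousLinearMap.precomp 𝕜 (NormedSpace.inclusionInDoubleDual 𝕜 E)).toLinearMap ∘ₗ j
  have hjR : ∀ w, j w = NormedSpace.inclusionInDoubleDual 𝕜 (StrongDual 𝕜 E) (R w) := by
    refine fun w => hE (j w) fun a r ha => ?_
    obtain ⟨η, hη⟩ := StrongDual.exists_forall_tendsto_of_bounded (hyperfilter ℕ)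
      (fun n => T.symm (a n)) fun n => (T.symm.norm_map _).trans_le (ha n)
    refine ⟨T η, ?_, fun b s hs => ?_⟩
    · rw [hj, T.symm_apply_apply]
      exact hη w
    · have hlim : ∀ v, Tendsto (fun n => T.symm (b - a n) v) (hyperfilter ℕ)
          (𝓝 ((T.symm b - η) v)) := fun v => by
        refine ((hη v).const_sub (T.symm b v)).congr fun n => ?_
        rw [map_sub]
        rfl
      have h1 := StrongDual.norm_le_of_tendsto hlim
        (hs.mono fun n hn => (T.symm.norm_map _).trans_le hn)
      rwa [← T.norm_map, map_sub, T.apply_symm_apply] at h1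
  have happly : ∀ w (a : StrongDual 𝕜 (StrongDual 𝕜 E)), a (R w) = T.symm a w := fun w a => by
    rw [← hj, hjR]
    rfl
  have hnorm : ∀ w, ‖R w‖ = ‖w‖ := fun w => by
    refine le_antisymm ?_ ?_
    · refine NormedSpace.norm_le_dual_bound 𝕜 _ (norm_nonneg w) fun a => ?_
      rw [happly, ← T.symm.norm_map a, mul_comm]
      exact (T.symm a).le_opNorm w
    · refine NormedSpace.norm_le_dual_bound 𝕜 _ (norm_nonneg _) fun v => ?_
      rw [← T.symm_apply_apply v, ← happly, T.symm_apply_apply, ← T.norm_map v, mul_comm]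
      exact (T v).le_opNorm _
  let Ri : W →ₗᵢ[𝕜] StrongDual 𝕜 E := ⟨R, hnorm⟩
  refine ⟨LinearIsometryEquiv.ofSurjective Ri fun z => ?_⟩
  -- Completeness of `W` makes the range closed. If it were proper, some nonzero `a ∈ E**` would
  -- vanish on it; but then `T.symm a` vanishes on `W`, so `a = 0`.
  have hclosed : IsClosed (LinearMap.range R : Set (StrongDual 𝕜 E)) := by
    rw [LinearMap.coe_range]
    exact (Ri.isometry.isUniformInducing.isComplete_range).isClosed
  by_contra hz
  obtain ⟨a, ha, haz⟩ := Submodule.exists_strongDual_ne_zero_of_notMem _ hclosed (x := z) hz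
  refine haz ?_
  have h0 : T.symm a = 0 := by
    ext w
    rw [← happly]
    exact ha _ ⟨w, rfl⟩
  rw [← T.apply_symm_apply a, h0, map_zero]
  rfl

end

/-! ### The limit condition for `M₀` -/

section

variable {𝕜 X Y ι : Type*} [RCLike 𝕜] [NormedAddCommGroup X] [NormedSpace 𝕜 X]
  [NormedAddCommGroup Y] [NormedSpace 𝕜 Y] [TopologicalSpace ι] {Λ : ι → X →L[𝕜] Y}

/-- Off a compact set `K` the `y` term is below `ε` and `x - u n` costs at most `2‖x‖`; on `K`,
uniform boundedness turns convergence in `X` into smallness of `x - u n`. -/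
theorem eventually_norm_add_sub_le [CompleteSpace X]
    (hcont : ∀ x : X, Continuous fun i => Λ i x) {x : BigSpace Λ} {u : ℕ → littleSpace Λ}
    (hu : Tendsto (fun n => BigSpace.toX Λ (u n)) atTop (𝓝 (BigSpace.toX Λ x)))
    (hux : ∀ n, ‖u n‖ ≤ ‖x‖) (y : littleSpace Λ) {ε : ℝ} (hε : 0 < ε) :
    ∀ᶠ n in atTop, ‖(y : BigSpace Λ) + x - u n‖ ≤ max ‖y‖ (2 * ‖x‖) + ε := by
  obtain ⟨K, hK, hKy⟩ := mem_cocompact.1 (Filter.Tendsto.eventually_lt_const hε y.2)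
  obtain ⟨C, hC0, hC⟩ := exists_bound_on_isCompact hcont hK
  have hlim : Tendsto (fun n => C * ‖BigSpace.toX Λ x - BigSpace.toX Λ (u n)‖) atTop (𝓝 0) := by
    simpa using ((hu.const_sub (BigSpace.toX Λ x)).norm).const_mul C
  filter_upwards [hlim.eventually_le_const hε] with n hn
  have hmax : 0 ≤ max ‖y‖ (2 * ‖x‖) := (norm_nonneg y).trans (le_max_left _ _)
  refine BigSpace.norm_le_of_forall (by positivity) fun i => ?_
  rw [add_sub_assoc, map_add, map_add]
  refine (norm_add_le _ _).trans ?_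
  by_cases hi : i ∈ K
  · refine add_le_add ((BigSpace.norm_apply_le (y : BigSpace Λ) i).trans (le_max_left _ _)) ?_
    rw [map_sub]
    exact (hC i hi _).trans hn
  · rw [add_comm]
    refine add_le_add ((BigSpace.norm_apply_le _ i).trans ?_) (le_of_lt (hKy hi))
    refine (norm_sub_le _ _).trans (le_trans ?_ (le_max_right _ _))
    have : ‖(u n : BigSpace Λ)‖ ≤ ‖x‖ := hux n
    linarith

/-- An approximating sequence in `M₀(X, 𝓛)` of `x` has at most `x` as a limit, for any notion of
limit for which the norm of `M(X, 𝓛)` is lower semicontinuous. -/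
theorem eq_of_forall_norm_sub_le [CompleteSpace X]
    (hcont : ∀ x : X, Continuous fun i => Λ i x)
    (hM : ∃ C : ℝ, ∀ x : BigSpace Λ, ‖BigSpace.toX Λ x‖ ≤ C * ‖x‖)
    (happrox : ∀ x : BigSpace Λ, ∃ u : ℕ → littleSpace Λ,
      Tendsto (fun n => BigSpace.toX Λ (u n)) atTop (𝓝 (BigSpace.toX Λ x)) ∧
      ∀ n, ‖u n‖ ≤ ‖x‖) {x y : BigSpace Λ} {u : ℕ → littleSpace Λ}
    (hu : Tendsto (fun n => BigSpace.toX Λ (u n)) atTop (𝓝 (BigSpace.toX Λ x)))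
    (hux : ∀ n, ‖u n‖ ≤ ‖x‖)
    (hy : ∀ (b : BigSpace Λ) (s : ℝ), (∀ᶠ n in atTop, ‖b - u n‖ ≤ s) → ‖b - y‖ ≤ s) :
    y = x := by
  have hlittle : ∀ v : littleSpace Λ, ‖(v : BigSpace Λ) + (x - y)‖ ≤ max ‖v‖ (2 * ‖x‖) := by
    refine fun v => le_of_forall_pos_le_add fun ε hε => ?_
    rw [← add_sub_assoc]
    exact hy _ _ (eventually_norm_add_sub_le hcont hu hux v hε)
  -- From `M₀` to `M`: approximate `v` in `X` without increasing its norm, and pass to the limit for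
  -- each operator separately.
  have hbig : ∀ v : BigSpace Λ, ‖v + (x - y)‖ ≤ max ‖v‖ (2 * ‖x‖) := by
    intro v
    obtain ⟨w, hw, hwv⟩ := happrox v
    refine BigSpace.norm_le_of_forall ((norm_nonneg v).trans (le_max_left _ _)) fun i => ?_
    have hlim : Tendsto (fun n => ‖Λ i (BigSpace.toX Λ (w n) + BigSpace.toX Λ (x - y))‖) atTop
        (𝓝 ‖Λ i (BigSpace.toX Λ v + BigSpace.toX Λ (x - y))‖) :=
      (((Λ i).continuous.tendsto _).comp (hw.add_const _)).norm
    rw [map_add]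
    refine le_of_tendsto hlim (.of_forall fun n => ?_)
    rw [← map_add]
    exact (BigSpace.norm_apply_le _ i).trans
      ((hlittle (w n)).trans (max_le_max_right _ (hwv n)))
  have hzero : ‖x - y‖ = 0 := by
    by_contra hne
    have hpos : 0 < ‖x - y‖ := lt_of_le_of_ne (norm_nonneg _) (Ne.symm hne)
    -- With `k` this large the maximum is `k * ‖x - y‖`, so taking `v = k (x - y)` gives `(k + 1) *
    -- ‖x - y‖ ≤ k * ‖x - y‖`.
    obtain ⟨k, hk⟩ := exists_nat_ge (2 * ‖x‖ / ‖x - y‖)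
    rw [div_le_iff₀ hpos] at hk
    have hnk : ∀ k : ℕ, ‖((k : ℝ) : 𝕜) • (x - y)‖ = k * ‖x - y‖ := fun k => by
      rw [norm_smul, RCLike.norm_ofReal, abs_of_nonneg k.cast_nonneg]
    have h := hbig (((k : ℝ) : 𝕜) • (x - y))
    have e : ((k : ℝ) : 𝕜) • (x - y) + (x - y) = (((k + 1 : ℕ) : ℝ) : 𝕜) • (x - y) := by
      push_cast
      rw [add_smul, one_smul]
    rw [e, hnk, hnk, max_eq_left hk] at h
    push_cast at h
    linarith
  exact (sub_eq_zero.1 (BigSpace.eq_zero_of_norm_eq_zero hM hzero)).symm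

theorem limitFunctionalsComeFromDual_littleSpace [CompleteSpace X]
    (hcont : ∀ x : X, Continuous fun i => Λ i x)
    (hM : ∃ C : ℝ, ∀ x : BigSpace Λ, ‖BigSpace.toX Λ x‖ ≤ C * ‖x‖)
    (happrox : ∀ x : BigSpace Λ, ∃ u : ℕ → littleSpace Λ,
      Tendsto (fun n => BigSpace.toX Λ (u n)) atTop (𝓝 (BigSpace.toX Λ x)) ∧
      ∀ n, ‖u n‖ ≤ ‖x‖)
    (I : StrongDual 𝕜 (StrongDual 𝕜 (littleSpace Λ)) ≃ₗᵢ[𝕜] BigSpace Λ)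
    (hI : ∀ (m : StrongDual 𝕜 (StrongDual 𝕜 (littleSpace Λ))) (g : StrongDual 𝕜 X),
      g (BigSpace.toX Λ (I m)) = m (g.comp (littleSpaceInclusion hM))) :
    LimitFunctionalsComeFromDual 𝕜 (littleSpace Λ) := by
  intro f hf
  let ι₀ := NormedSpace.inclusionInDoubleDual 𝕜 (littleSpace Λ)
  have toX_ext : ∀ x y : BigSpace Λ,
      (∀ g : StrongDual 𝕜 X, g (BigSpace.toX Λ x) = g (BigSpace.toX Λ y)) → x = y :=
    fun x y h => BigSpace.toX_injective
      ((NormedSpace.inclusionInDoubleDualLi 𝕜 (E := X)).injective (ContinuousLinearMap.ext h))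
  have hIι : ∀ v : littleSpace Λ, I (ι₀ v) = v := fun v => toX_ext _ _ fun g => hI _ g
  ext m
  obtain ⟨u, hu, hux⟩ := happrox (I m)
  have hb : ∀ n, ‖ι₀ (u n)‖ ≤ ‖I m‖ :=
    fun n => (NormedSpace.double_dual_bound 𝕜 _ _).trans (hux n)
  obtain ⟨y, hfy, hy⟩ := hf (fun n => ι₀ (u n)) _ hb
  obtain ⟨m', hm'⟩ := StrongDual.exists_forall_tendsto_of_bounded (hyperfilter ℕ) _ hb
  have hym : y = m := by
    refine I.toLinearEquiv.injective ?_
    refine eq_of_forall_norm_sub_le hcont hM happrox hu hux fun b s hs => ?_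
    have := hy (I.symm b) s ((hs.filter_mono Nat.hyperfilter_le_atTop).mono fun n hn => by
      rwa [← I.norm_map, map_sub, I.apply_symm_apply, hIι])
    rwa [← I.norm_map, map_sub, I.apply_symm_apply] at this
  have hmm : m' = m := by
    refine I.toLinearEquiv.injective (toX_ext _ _ fun g => ?_)
    change g (BigSpace.toX Λ (I m')) = g (BigSpace.toX Λ (I m))
    rw [hI]
    refine tendsto_nhds_unique (hm' _) ?_
    exact ((g.continuous.tendsto _).comp hu).mono_left Nat.hyperfilter_le_atTop
  rw [hym] at hfy
  rw [hmm] at hm'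
  -- `f (ι₀ (u n))` is also the pairing of `ι₀ (u n)` with `f.comp ι₀`, so its limit is both `f m`
  -- and `m (f.comp ι₀)`.
  exact tendsto_nhds_unique hfy (hm' (f.comp ι₀))

end

theorem mainTheorem3 {𝕜 X Y ι : Type*} [RCLike 𝕜]
    [NormedAddCommGroup X] [NormedSpace 𝕜 X] [CompleteSpace X]
    [TopologicalSpace.SeparableSpace X]
    (hrefl : Function.Surjective (NormedSpace.inclusionInDoubleDual 𝕜 X))
    [NormedAddCommGroup Y] [NormedSpace 𝕜 Y] [CompleteSpace Y]
    [TopologicalSpace ι] [T2Space ι] [LocallyCompactSpace ι] [SigmaCompactSpace ι]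
    (Λ : ι → X →L[𝕜] Y)
    (hcont : ∀ x : X, Continuous fun i => Λ i x)
    -- `M(X, 𝓛)` is continuously contained in `X`
    (hM : ∃ C : ℝ, ∀ x : BigSpace Λ, ‖BigSpace.toX Λ x‖ ≤ C * ‖x‖)
    -- every `x` in `M(X, 𝓛)` is an `X`-limit of elements of `M₀(X, 𝓛)` of no larger norm
    (happrox : ∀ x : BigSpace Λ, ∃ u : ℕ → littleSpace Λ,
      Tendsto (fun n => BigSpace.toX Λ (u n)) atTop (𝓝 (BigSpace.toX Λ x)) ∧
      ∀ n, ‖u n‖ ≤ ‖x‖) :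
    -- `M₀(X, 𝓛)*` is an isometric predual of `M(X, 𝓛)`; the isometry is the adjoint of the
    -- restriction map from `X*` to `M₀(X, 𝓛)*`
    (∃ I : StrongDual 𝕜 (StrongDual 𝕜 (littleSpace Λ)) ≃ₗᵢ[𝕜] BigSpace Λ,
      ∀ (m : StrongDual 𝕜 (StrongDual 𝕜 (littleSpace Λ))) (g : StrongDual 𝕜 X)
        (h : StrongDual 𝕜 (littleSpace Λ)),
        (∀ y : littleSpace Λ, h y = g (BigSpace.toX Λ y)) → g (BigSpace.toX Λ (I m)) = m h) ∧
    -- it is strongly unique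
    IsStronglyUniquePredual 𝕜 (StrongDual 𝕜 (littleSpace Λ)) ∧
    -- it is unique up to isometry
    (∀ (W : Type*) [NormedAddCommGroup W] [NormedSpace 𝕜 W] [CompleteSpace W],
      Nonempty (StrongDual 𝕜 W ≃ₗᵢ[𝕜] BigSpace Λ) →
      Nonempty (W ≃ₗᵢ[𝕜] StrongDual 𝕜 (littleSpace Λ))) := by
  obtain ⟨I, hI⟩ := exists_bidual_littleSpace_isometry hrefl hcont hM happrox
  have hE := limitFunctionalsComeFromDual_littleSpace hcont hM happrox I hI
  refine ⟨⟨I, fun m g h hg => ?_⟩, hE.isStronglyUniquePredual, fun W _ _ _ ⟨T⟩ =>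
    hE.nonempty_isometry (T.trans I.symm)⟩
  rw [hI]
  exact congrArg m (ContinuousLinearMap.ext fun y => (hg y).symm)
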